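/- Let $n\ge 0$ and $S=\mathbb{C}[x_0,\ldots,x_n]$. For a collection $\mathcal F$ of forms (homogeneous polynomials) in $S$, the simultaneous Waring rank $\mathrm{rk}_{\mathbb C}\,\mathcal F$ is the minimal integer $r$ such that there exist linear forms $L_1,\ldots,L_r\in S$ with the property that every $F\in\mathcal F$ can be written as $F=\sum_{j=1}^r\lambda_{F,j}\,L_j^{\deg F}$ with $\lambda_{F,j}\in\mathbb C$ (the forms in $\mathcal F$ may have different degrees). For a single form, $\mathrm{rk}_{\mathbb C}\,F=\mathrm{rk}_{\mathbb C}\{F\}$ is its Waring rank. Theorem. Let $M_1=x_0^c x_1^{a_1}\cdots x_n^{a_n}$ and $M_2=x_0^c x_1^{b_1}\cdots x_n^{b_n}$, where $c\ge 1$, and $c\le a_i$ and $c\le b_i$ for $i=1,\ldots,n$, and let $M_{12}=\gcd(M_1,M_2)$ be the greatest common divisor of $M_1$ and $M_2$ in $S$ (it is unique up to a nonzero constant factor). Suppose that, for each $i=1,\ldots,n$, $|a_i-b_i|=0$ or $|a_i-b_i|=1$ or $|a_i-b_i|\ge c+1$. Then the ranks below are finite and $$\mathrm{rk}_{\mathbb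 C}\{M_1,M_2\}=\mathrm{rk}_{\mathbb C}\,M_1+\mathrm{rk}_{\mathbb C}\,M_2-\mathrm{rk}_{\mathbb C}\,M_{12}.$$ -/

import Mathlib

/-- Over `ℂ`, in the variables `x₀, …, xₙ`, there are `r` linear forms `L₁, …, L_r` such that
every `F` in the collection is a linear combination of the powers `L_j ^ deg F`. The linear
forms are common to all members of the collection; the coefficients may depend on `F`. -/
def HasSimultaneousWaringDecomposition {n : ℕ}
    (𝓕 : Set (MvPolynomial (Fin (n + 1)) ℂ)) (r : ℕ) : Prop :=
  ∃ L : Fin r → MvPolynomial (Fin (n + 1)) ℂ, (∀ j, (L j).IsHomogeneous 1) ∧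
    ∀ F ∈ 𝓕, ∃ coeffs : Fin r → ℂ,
      F = ∑ j, MvPolynomial.C (coeffs j) * L j ^ F.totalDegree

/-- The simultaneous Waring rank over `ℂ` of a collection of forms: the least number of linear
forms in a simultaneous decomposition, and `⊤` when there is no such decomposition. -/
noncomputable def simultaneousWaringRank {n : ℕ}
    (𝓕 : Set (MvPolynomial (Fin (n + 1)) ℂ)) : ℕ∞ :=
  ⨅ (r : ℕ) (_ : HasSimultaneousWaringDecomposition 𝓕 r), (r : ℕ∞)

/-- The Waring rank over `ℂ` of a single form. -/
noncomputable def waringRank {n : ℕ} (F : MvPolynomial (Fin (n + 1)) ℂ) : ℕ∞ :=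
  simultaneousWaringRank {F}

/-- The monomial `x₀ ^ c * x₁ ^ a₁ * ⋯ * xₙ ^ aₙ`; the exponent `a i` with `i : Fin n` belongs to
the variable with index `i + 1`. -/
noncomputable def specialMonomial {n : ℕ} (c : ℕ) (a : Fin n → ℕ) :
    MvPolynomial (Fin (n + 1)) ℂ :=
  MvPolynomial.X 0 ^ c * ∏ i : Fin n, MvPolynomial.X i.succ ^ a i

/-- `D` is a greatest common divisor of `F` and `G` in the polynomial ring (such a `D` is unique
up to a nonzero constant factor). -/
def IsGreatestCommonDivisor {n : ℕ} (F G D : MvPolynomial (Fin (n + 1)) ℂ) : Prop :=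
  D ∣ F ∧ D ∣ G ∧ ∀ E, E ∣ F → E ∣ G → E ∣ D

/-!
By apolarity, the monomial with exponent vector `s` is a linear combination of the `|s|`-th powers
of the linear forms with coefficient vectors `z ∈ Z` if and only if every form of degree `|s|`
vanishing on `Z` has coefficient `0` at `s`. For `M₁` and `M₂` the least number of points turns out
to be the number of exponent vectors `m : Fin n → ℕ` with `m ≤ a` or `m ≤ b`, and
inclusion–exclusion gives the formula.

With fewer points, some nonzero `g` in the variables `x₁, …, xₙ` whose exponents are all below `a`
or below `b` vanishes at the points outside `x₀ = 0`. If its leading exponent `m` is below `a`,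
then the form of degree `c + |a|` obtained from `x ^ (a - m) * g` by homogenizing is divisible by
`x₀`, because `c ≥ 1`; hence it vanishes on `Z`, while its coefficient at `(c, a)` is nonzero.

Conversely, take a grid of points with `x₀ = 1` whose `i`th coordinates are the roots of some
`X ^ (a i + 1) + h` with `deg h ≤ a i - c`. By the Combinatorial Nullstellensatz the polynomials
vanishing there are combinations of these with control on the degrees, so no monomial `x ^ a`
occurs in one of degree at most `c + |a|`. The hypothesis on `|a i - b i|` makes it possible to
choose the nodes for `a i` among those for `b i` if `a i ≤ b i`: adjoin the root `0` or the roots of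
`X ^ (b i - a i) - 2` to those of `X ^ (a i + 1) - 1`. The two grids then overlap in exactly
`∏ i, (min (a i) (b i) + 1)` points.
-/

section Homogenization

open MvPolynomial

variable {R K : Type*} {n N : ℕ}

theorem degree_finsuppCons (k : ℕ) (m : Fin n →₀ ℕ) :
    (Finsupp.cons k m).degree = k + m.degree := by
  simp [Finsupp.degree_eq_sum, Fin.sum_univ_succ]

/-- The homogenization of `g` in degree `N`, by powers of the new variable `X 0`: the monomial with
exponent vector `m` is multiplied by `X 0 ^ (N - |m|)`. The subtraction is truncated, so this is
meaningful only for `g` of total degree at most `N`. -/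
noncomputable def homogenize [CommSemiring R] (N : ℕ) :
    MvPolynomial (Fin n) R →ₗ[R] MvPolynomial (Fin (n + 1)) R :=
  (basisMonomials (Fin n) R).constr R fun m => monomial (Finsupp.cons (N - m.degree) m) 1

theorem homogenize_monomial [CommSemiring R] (m : Fin n →₀ ℕ) (x : R) :
    homogenize N (monomial m x) = monomial (Finsupp.cons (N - m.degree) m) x := by
  have h : homogenize N (monomial m (1 : R)) = monomial (Finsupp.cons (N - m.degree) m) 1 :=
    (basisMonomials (Fin n) R).constr_basis R _ m
  rw [← mul_one x, ← smul_eq_mul, ← smul_monomial, ← smul_monomial, map_smul, h]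

theorem homogenize_eq_sum [CommSemiring R] (g : MvPolynomial (Fin n) R) :
    homogenize N g =
      ∑ m ∈ g.support, monomial (Finsupp.cons (N - m.degree) m) (g.coeff m) := by
  conv_lhs => rw [g.as_sum, map_sum]
  simp only [homogenize_monomial]

theorem isHomogeneous_homogenize [CommSemiring R] {g : MvPolynomial (Fin n) R}
    (hg : g.totalDegree ≤ N) : (homogenize N g).IsHomogeneous N := by
  rw [homogenize_eq_sum]
  refine .sum _ _ _ fun m hm => isHomogeneous_monomial _ ?_
  rw [degree_finsuppCons]
  exact Nat.sub_add_cancel ((le_totalDegree hm).trans hg)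

theorem coeff_homogenize [CommSemiring R] (g : MvPolynomial (Fin n) R) {k : ℕ}
    {m : Fin n →₀ ℕ} (hkm : k + m.degree = N) :
    (homogenize N g).coeff (Finsupp.cons k m) = g.coeff m := by
  classical
  obtain rfl : k = N - m.degree := by omega
  induction g using MvPolynomial.induction_on' with
  | monomial m' x =>
    rw [homogenize_monomial, coeff_monomial, coeff_monomial]
    refine if_congr ⟨fun h => (Finsupp.cons_injective2 h).2, ?_⟩ rfl rfl
    rintro rfl
    rfl
  | add f g hf hg => rw [map_add, coeff_add, coeff_add, hf, hg]

theorem eval_homogenize [Field K] {g : MvPolynomial (Fin n) K} (hg : g.totalDegree ≤ N)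
    {z : Fin (n + 1) → K} (hz : z 0 ≠ 0) :
    eval z (homogenize N g) = z 0 ^ N * eval (fun i => z i.succ / z 0) g := by
  rw [homogenize_eq_sum, map_sum, eval_eq', Finset.mul_sum]
  refine Finset.sum_congr rfl fun m hm => ?_
  have hmN : m.degree ≤ N := (le_totalDegree hm).trans hg
  rw [eval_monomial, Finsupp.prod_fintype _ _ (by simp), Fin.prod_univ_succ]
  simp only [Finsupp.cons_zero, Finsupp.cons_succ, div_pow, Finset.prod_div_distrib,
    Finset.prod_pow_eq_pow_sum, ← Finsupp.degree_eq_sum, pow_sub₀ _ hz hmN]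
  field

theorem eval_homogenize_eq_zero [CommSemiring R] {g : MvPolynomial (Fin n) R}
    (hg : g.totalDegree < N) {z : Fin (n + 1) → R} (hz : z 0 = 0) :
    eval z (homogenize N g) = 0 := by
  rw [homogenize_eq_sum, map_sum]
  refine Finset.sum_eq_zero fun m hm => ?_
  have hmN : N - m.degree ≠ 0 := (Nat.sub_pos_of_lt ((le_totalDegree hm).trans_lt hg)).ne'
  rw [eval_monomial, Finsupp.prod_fintype _ _ (by simp), Fin.prod_univ_succ, Finsupp.cons_zero, hz,
    zero_pow hmN, zero_mul, mul_zero]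

theorem exists_homogenize_eq [CommSemiring R] {G : MvPolynomial (Fin (n + 1)) R}
    (hG : G.IsHomogeneous N) :
    ∃ g : MvPolynomial (Fin n) R, g.totalDegree ≤ N ∧ homogenize N g = G := by
  have hdeg : ∀ m ∈ G.support, m 0 + m.tail.degree = N := fun m hm => by
    rw [← degree_finsuppCons, Finsupp.cons_tail, hG.degree_eq_sum_deg_support hm]
    rfl
  refine ⟨∑ m ∈ G.support, monomial m.tail (G.coeff m), ?_, ?_⟩
  · refine totalDegree_finsetSum_le fun m hm => (totalDegree_monomial_le _ _).trans ?_
    exact (Nat.le_add_left _ _).trans (hdeg m hm).le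
  · conv_rhs => rw [G.as_sum]
    rw [map_sum]
    refine Finset.sum_congr rfl fun m hm => ?_
    rw [homogenize_monomial, ← hdeg m hm, Nat.add_sub_cancel, Finsupp.cons_tail]

end Homogenization

section Apolarity

open MvPolynomial

variable {σ K ι : Type*}

/-- The points of `Z` are apolar to the monomial with exponent vector `s`: every form of the degree
of that monomial which vanishes on `Z` annihilates it when the variables act as partial derivatives.
On forms of that degree the action picks out, up to a factorial factor, the coefficient at `s`, and
this is how the condition is encoded. -/
def IsApolar [CommSemiring K] (Z : Set (σ → K)) (s : σ →₀ ℕ) : Prop :=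
  ∀ ⦃G : MvPolynomial σ K⦄, G.IsHomogeneous s.degree → (∀ z ∈ Z, eval z G = 0) → G.coeff s = 0

theorem IsApolar.mono [CommSemiring K] {Z Z' : Set (σ → K)} {s : σ →₀ ℕ} (h : IsApolar Z s)
    (hZ : Z ⊆ Z') : IsApolar Z' s :=
  fun _ hG hG0 => h hG fun z hz => hG0 z (hZ hz)

theorem multinomial_cast_ne_zero [AddMonoidWithOne K] [CharZero K] (m : σ →₀ ℕ) :
    (m.multinomial : K) ≠ 0 := by
  rw [Finsupp.multinomial_eq, Nat.cast_ne_zero]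
  exact (Nat.multinomial_pos _ _).ne'

theorem coeff_sum_smul_X_pow [Fintype σ] [CommSemiring K] (l : σ → K) (m : σ →₀ ℕ) (d : ℕ) :
    ((∑ i, l i • X i : MvPolynomial σ K) ^ d).coeff m =
      if m.degree = d then m.multinomial * eval l (monomial m 1) else 0 := by
  rw [coeff_linearCombination_X_pow_of_fintype, eval_monomial, one_mul]
  rfl

variable [Field K]

theorem isApolar_range_iff_exists_coeff_eq_sum_eval [Fintype ι] {p : ι → σ → K} {s : σ →₀ ℕ} :
    IsApolar (Set.range p) s ↔ ∃ w : ι → K, ∀ G : MvPolynomial σ K,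
      G.IsHomogeneous s.degree → G.coeff s = ∑ j, w j * eval (p j) G := by
  refine ⟨fun h => ?_, fun ⟨w, hw⟩ G hG hG0 => ?_⟩
  · let incl := (homogeneousSubmodule σ K s.degree).subtype
    have hker : ⨅ j, LinearMap.ker ((aeval (p j)).toLinearMap ∘ₗ incl) ≤
        LinearMap.ker (lcoeff K s ∘ₗ incl) := by
      intro G hG
      simp only [Submodule.mem_iInf, LinearMap.mem_ker] at hG
      exact h G.2 (by simpa [incl, coe_aeval_eq_eval] using hG)
    obtain ⟨w, hw⟩ := (Submodule.mem_span_range_iff_exists_fun K).1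
      (mem_span_of_iInf_ker_le_ker hker)
    refine ⟨w, fun G hG => ?_⟩
    simpa [incl, coe_aeval_eq_eval] using (LinearMap.congr_fun hw ⟨G, hG⟩).symm
  · rw [hw G hG]
    exact Finset.sum_eq_zero fun j _ => by rw [hG0 _ ⟨j, rfl⟩, mul_zero]

theorem forall_isHomogeneous_coeff_eq_sum_eval_iff [Fintype ι] {p : ι → σ → K} {s : σ →₀ ℕ}
    {w : ι → K} :
    (∀ G : MvPolynomial σ K, G.IsHomogeneous s.degree → G.coeff s = ∑ j, w j * eval (p j) G) ↔
      ∀ m : σ →₀ ℕ, m.degree = s.degree →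
        (monomial m (1 : K)).coeff s = ∑ j, w j * eval (p j) (monomial m 1) := by
  refine ⟨fun h m hm => h _ (isHomogeneous_monomial _ hm), fun h G hG => ?_⟩
  rw [← mem_homogeneousSubmodule, homogeneousSubmodule_eq_finsupp_supported,
    AddMonoidAlgebra.supported_eq_span_single] at hG
  have hspan : Submodule.span K ((monomial · (1 : K)) '' {m : σ →₀ ℕ | m.degree = s.degree}) ≤
      LinearMap.eqLocus (lcoeff K s) (∑ j, w j • (aeval (p j)).toLinearMap) := by
    rw [Submodule.span_le, Set.image_subset_iff]
    intro m hm
    simpa [coe_aeval_eq_eval] using h m hm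
  simpa [coe_aeval_eq_eval] using hspan hG

theorem monomial_multinomial_eq_sum_pow_iff [Fintype σ] [CharZero K] [Fintype ι] {p : ι → σ → K}
    {s : σ →₀ ℕ} {w : ι → K} :
    monomial s (s.multinomial : K) = ∑ j, C (w j) * (∑ i, p j i • X i) ^ s.degree ↔
      ∀ m : σ →₀ ℕ, m.degree = s.degree →
        (monomial m (1 : K)).coeff s = ∑ j, w j * eval (p j) (monomial m 1) := by
  classical
  rw [MvPolynomial.ext_iff]
  refine forall_congr' fun m => ?_
  simp only [coeff_monomial, coeff_sum, coeff_C_mul, coeff_sum_smul_X_pow]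
  by_cases hm : m.degree = s.degree
  · have hsum : ∑ j, w j * ((m.multinomial : K) * eval (p j) (monomial m 1)) =
        m.multinomial * ∑ j, w j * eval (p j) (monomial m 1) := by
      rw [Finset.mul_sum]
      exact Finset.sum_congr rfl fun j _ => mul_left_comm _ _ _
    have hcoeff : (if s = m then (s.multinomial : K) else 0) =
        m.multinomial * if m = s then 1 else 0 := by
      rcases eq_or_ne m s with rfl | h
      · simp
      · simp [h, h.symm]
    simp only [hm, if_true, hsum, hcoeff, mul_right_inj' (multinomial_cast_ne_zero m),
      forall_const]
  · have hne : s ≠ m := by rintro rfl; exact hm rfl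
    simp [hm, hne]

theorem isApolar_range_iff_exists_monomial_eq_sum_pow [Fintype σ] [CharZero K] [Fintype ι]
    {p : ι → σ → K} {s : σ →₀ ℕ} :
    IsApolar (Set.range p) s ↔ ∃ w : ι → K,
      monomial s (1 : K) = ∑ j, C (w j) * (∑ i, p j i • X i) ^ s.degree := by
  simp only [isApolar_range_iff_exists_coeff_eq_sum_eval,
    forall_isHomogeneous_coeff_eq_sum_eval_iff, ← monomial_multinomial_eq_sum_pow_iff]
  have rescale : ∀ (x y u : K) (w : ι → K), u * x = y →
      monomial s x = ∑ j, C (w j) * (∑ i, p j i • X i) ^ s.degree →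
      monomial s y = ∑ j, C (u * w j) * (∑ i, p j i • X i) ^ s.degree := by
    rintro x _ u w rfl h
    simp only [← C_mul_monomial, h, Finset.mul_sum, map_mul, mul_assoc]
  have hs : (s.multinomial : K) ≠ 0 := multinomial_cast_ne_zero s
  exact ⟨fun ⟨w, hw⟩ => ⟨_, rescale _ _ _ w (inv_mul_cancel₀ hs) hw⟩,
    fun ⟨w, hw⟩ => ⟨_, rescale _ _ _ w (mul_one _) hw⟩⟩

end Apolarity

section LowerBound

open MvPolynomial

variable {σ K : Type*}

theorem exists_degree_eq_totalDegree [CommSemiring K] {g : MvPolynomial σ K} (hg : g ≠ 0) :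
    ∃ m ∈ g.support, m.degree = g.totalDegree := by
  obtain ⟨m, hm, h⟩ := Finset.exists_mem_eq_sup g.support (support_nonempty.2 hg) fun m => m.degree
  exact ⟨m, hm, h.symm⟩

theorem exists_ne_zero_support_subset_eval_eq_zero [Field K] {D : Finset (σ →₀ ℕ)}
    {Z : Finset (σ → K)} (hDZ : Z.card < D.card) :
    ∃ g : MvPolynomial σ K, g ≠ 0 ∧ g.support ⊆ D ∧ ∀ z ∈ Z, eval z g = 0 := by
  let b := basisRestrictSupport K (D : Set (σ →₀ ℕ))
  have : Module.Finite K (restrictSupport K (D : Set (σ →₀ ℕ))) := .of_basis b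
  let evalAtZ : restrictSupport K (D : Set (σ →₀ ℕ)) →ₗ[K] Z → K :=
    .pi fun z => (aeval z.1).toLinearMap ∘ₗ Submodule.subtype _
  have hrank : Module.finrank K (Z → K) <
      Module.finrank K (restrictSupport K (D : Set (σ →₀ ℕ))) := by
    simpa [Module.finrank_eq_card_basis b] using hDZ
  obtain ⟨g, hg, hg0⟩ := (LinearMap.ker evalAtZ).ne_bot_iff.1
    (LinearMap.ker_ne_bot_of_finrank_lt hrank)
  refine ⟨g, by simpa using hg0, by simpa using (mem_restrictSupport_iff K).1 g.2, fun z hz => ?_⟩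
  simpa [evalAtZ, coe_aeval_eq_eval] using congr_fun hg ⟨z, hz⟩

theorem IsApolar.coeff_eq_zero [Field K] {n c : ℕ} {a : Fin n →₀ ℕ} {Z : Set (Fin (n + 1) → K)}
    (h : IsApolar Z (Finsupp.cons c a)) {f : MvPolynomial (Fin n) K}
    (hf : f.totalDegree < c + a.degree)
    (hZ : ∀ z ∈ Z, z 0 ≠ 0 → eval (fun i => z i.succ / z 0) f = 0) : f.coeff a = 0 := by
  rw [← coeff_homogenize f rfl]
  refine h ?_ fun z hz => ?_
  · rw [degree_finsuppCons]
    exact isHomogeneous_homogenize hf.le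
  · by_cases hz0 : z 0 = 0
    · exact eval_homogenize_eq_zero hf hz0
    · rw [eval_homogenize hf.le hz0, hZ z hz hz0, mul_zero]

theorem card_le_card_of_isApolar [Field K] {n c : ℕ} (hc : c ≠ 0) {D : Finset (Fin n →₀ ℕ)}
    {Z : Finset (Fin (n + 1) → K)}
    (h : ∀ m ∈ D, ∃ a, m ≤ a ∧ IsApolar (Z : Set (Fin (n + 1) → K)) (Finsupp.cons c a)) :
    D.card ≤ Z.card := by
  classical
  by_contra! hDZ
  let dehomogenize (z : Fin (n + 1) → K) (i : Fin n) : K := z i.succ / z 0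
  obtain ⟨g, hg, hgD, hgZ⟩ := exists_ne_zero_support_subset_eval_eq_zero
    (Finset.card_image_le (f := dehomogenize).trans_lt hDZ)
  obtain ⟨m, hm, hmdeg⟩ := exists_degree_eq_totalDegree hg
  obtain ⟨a, hma, ha⟩ := h m (hgD hm)
  have hdeg : (monomial (a - m) 1 * g).totalDegree < c + a.degree := calc
    (monomial (a - m) 1 * g).totalDegree ≤ (a - m).degree + g.totalDegree :=
      (totalDegree_mul _ _).trans (Nat.add_le_add_right (totalDegree_monomial_le _ _) _)
    _ = a.degree := by rw [← hmdeg, ← map_add, tsub_add_cancel_of_le hma]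
    _ < c + a.degree := Nat.lt_add_of_pos_left (Nat.pos_of_ne_zero hc)
  have hcoeff : (monomial (a - m) 1 * g).coeff a = g.coeff m := by
    rw [coeff_monomial_mul', if_pos tsub_le_self, tsub_tsub_cancel_of_le hma, one_mul]
  refine mem_support_iff.1 hm (hcoeff ▸ ha.coeff_eq_zero hdeg fun z hz _ => ?_)
  rw [map_mul, hgZ _ (Finset.mem_image_of_mem dehomogenize hz), mul_zero]

end LowerBound

section Grid

open MvPolynomial

variable {K : Type*} {c : ℕ}

/-- The nodes `R` are the `a + 1` roots of a polynomial `X ^ (a + 1) + h` with a gap below its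
leading term: `h` has degree at most `a - c`, stated without truncated subtraction. Grids of such
node sets are apolar to `x₀ ^ c * x₁ ^ a₁ * ⋯ * xₙ ^ aₙ`. -/
def IsGappedNodeSet [CommRing K] (c a : ℕ) (R : Finset K) : Prop :=
  ∃ h : Polynomial K, h.natDegree + c ≤ a ∧
    ∏ z ∈ R, (Polynomial.X - Polynomial.C z) = Polynomial.X ^ (a + 1) + h

theorem IsGappedNodeSet.card_eq [CommRing K] [Nontrivial K] {a : ℕ} {R : Finset K}
    (hR : IsGappedNodeSet c a R) : R.card = a + 1 := by
  obtain ⟨h, hdeg, hprod⟩ := hR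
  have hlt : h.natDegree < (Polynomial.X ^ (a + 1) : Polynomial K).natDegree := by
    rw [Polynomial.natDegree_X_pow]
    omega
  rw [← Polynomial.natDegree_finsetProd_X_sub_C_eq_card (R := K), hprod,
    Polynomial.natDegree_add_eq_left_of_natDegree_lt hlt, Polynomial.natDegree_X_pow]

theorem totalDegree_aeval_X_le {σ : Type*} [CommSemiring K] [Nontrivial K] (i : σ)
    (h : Polynomial K) :
    (Polynomial.aeval (X i : MvPolynomial σ K) h).totalDegree ≤ h.natDegree := by
  rw [Polynomial.aeval_eq_sum_range]
  refine totalDegree_finsetSum_le fun k hk => (totalDegree_smul_le _ _).trans ?_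
  rw [totalDegree_X_pow]
  exact Nat.lt_succ_iff.1 (Finset.mem_range.1 hk)

theorem IsGappedNodeSet.coeff_prod_mul_eq_zero {σ : Type*} [CommRing K] [IsDomain K]
    {a : σ →₀ ℕ} {i : σ} {R : Finset K} (hR : IsGappedNodeSet c (a i) R) {q : MvPolynomial σ K}
    (hq : ((∏ z ∈ R, (X i - C z)) * q).totalDegree ≤ c + a.degree) :
    ((∏ z ∈ R, (X i - C z)) * q).coeff a = 0 := by
  classical
  obtain ⟨h, hdeg, hprod⟩ := hR
  obtain rfl | hq0 := eq_or_ne q 0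
  · simp
  have hP : ∏ z ∈ R, (X i - C z : MvPolynomial σ K) =
      X i ^ (a i + 1) + Polynomial.aeval (X i) h := by
    simpa [algebraMap_eq] using congr_arg (Polynomial.aeval (X i : MvPolynomial σ K)) hprod
  rw [hP] at hq ⊢
  have hdeg_h : (Polynomial.aeval (X i : MvPolynomial σ K) h).totalDegree ≤ h.natDegree :=
    totalDegree_aeval_X_le i h
  have hdegP : (X i ^ (a i + 1) + Polynomial.aeval (X i : MvPolynomial σ K) h).totalDegree =
      a i + 1 := by
    rw [totalDegree_add_eq_left_of_totalDegree_lt, totalDegree_X_pow]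
    rw [totalDegree_X_pow]
    omega
  have hP0 : X i ^ (a i + 1) + Polynomial.aeval (X i : MvPolynomial σ K) h ≠ 0 := by
    intro h0
    simp [h0] at hdegP
  rw [totalDegree_mul_of_isDomain hP0 hq0, hdegP] at hq
  have hlow : (Polynomial.aeval (X i) h * q).totalDegree < a.degree := by
    have := totalDegree_mul (Polynomial.aeval (X i) h) q
    omega
  have hhigh : (X i ^ (a i + 1) * q).coeff a = 0 := by
    rw [X_pow_eq_monomial, coeff_monomial_mul', if_neg]
    intro hle
    simpa using hle i
  rw [add_mul, coeff_add, hhigh, coeff_eq_zero_of_totalDegree_lt hlow, add_zero]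

theorem isApolar_grid [Field K] {n : ℕ} {a : Fin n →₀ ℕ} {R : Fin n → Finset K}
    (hR : ∀ i, IsGappedNodeSet c (a i) (R i)) :
    IsApolar (Matrix.vecCons 1 '' (Fintype.piFinset R : Set (Fin n → K)))
      (Finsupp.cons c a) := by
  intro G hG hG0
  rw [degree_finsuppCons] at hG
  obtain ⟨g, hg, rfl⟩ := exists_homogenize_eq hG
  have hgR : ∀ x : Fin n → K, (∀ i, x i ∈ R i) → eval x g = 0 := by
    intro x hx
    have hGx := hG0 _ (Set.mem_image_of_mem _ (Finset.mem_coe.2 (Fintype.mem_piFinset.2 hx)))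
    rw [eval_homogenize hg (by simp)] at hGx
    simpa using hGx
  have hne : ∀ i, (R i).Nonempty := fun i => Finset.card_pos.1 <| by
    rw [(hR i).card_eq]
    exact Nat.succ_pos _
  obtain ⟨q, hq, hgq⟩ := combinatorial_nullstellensatz_exists_linearCombination R hne g hgR
  rw [coeff_homogenize g rfl, hgq, Finsupp.linearCombination_apply, Finsupp.sum, coeff_sum]
  refine Finset.sum_eq_zero fun i _ => ?_
  rw [smul_eq_mul, mul_comm]
  exact (hR i).coeff_prod_mul_eq_zero ((hq i).trans hg)

end Grid

section NodeSets

open Polynomial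

variable {K : Type*}

theorem disjoint_nthRootsFinset_one_two [CommRing K] [IsDomain K] [CharZero K] {k l : ℕ}
    (hk : k ≠ 0) (hl : l ≠ 0) :
    Disjoint (nthRootsFinset k (1 : K)) (nthRootsFinset l (2 : K)) := by
  refine Finset.disjoint_left.2 fun z hz1 hz2 => ?_
  rw [mem_nthRootsFinset (Nat.pos_of_ne_zero hk)] at hz1
  rw [mem_nthRootsFinset (Nat.pos_of_ne_zero hl)] at hz2
  have h2 : (2 : K) ^ k = 1 := by rw [← hz2, ← pow_mul, mul_comm, pow_mul, hz1, one_pow]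
  have h2' : 2 ^ k = 1 := by exact_mod_cast h2
  simp [hk] at h2'

variable [Field K] [IsAlgClosed K]

theorem prod_nthRootsFinset_X_sub_C {m : ℕ} {q : K} (hm : (m : K) ≠ 0) (hq : q ≠ 0) :
    ∏ z ∈ nthRootsFinset m q, (X - C z) = X ^ m - C q := by
  classical
  have hnodup : (nthRoots m q).Nodup := nodup_roots (separable_X_pow_sub_C q hm hq)
  have hm0 : m ≠ 0 := by
    rintro rfl
    simp at hm
  rw [nthRootsFinset_def, ← Multiset.toFinset_eq hnodup]
  exact ((IsAlgClosed.splits _).eq_prod_roots_of_monic (monic_X_pow_sub_C q hm0)).symm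

variable [CharZero K] {c a b : ℕ}

theorem prod_nthRootsFinset_one_X_sub_C (a : ℕ) :
    ∏ z ∈ nthRootsFinset (a + 1) (1 : K), (X - C z) = X ^ (a + 1) - 1 := by
  rw [prod_nthRootsFinset_X_sub_C (Nat.cast_ne_zero.2 a.succ_ne_zero) one_ne_zero, C_1]

theorem isGappedNodeSet_nthRootsFinset_one (hca : c ≤ a) :
    IsGappedNodeSet c a (nthRootsFinset (a + 1) (1 : K)) := by
  refine ⟨-1, ?_, by rw [prod_nthRootsFinset_one_X_sub_C, sub_eq_add_neg]⟩
  rwa [natDegree_neg, natDegree_one, zero_add]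

theorem isGappedNodeSet_insert_zero_nthRootsFinset_one [DecidableEq K] (hca : c ≤ a) :
    IsGappedNodeSet c (a + 1) (insert 0 (nthRootsFinset (a + 1) (1 : K))) := by
  have h0 : (0 : K) ∉ nthRootsFinset (a + 1) (1 : K) := by
    simp [mem_nthRootsFinset a.succ_pos]
  refine ⟨-X, ?_, ?_⟩
  · rw [natDegree_neg, natDegree_X]
    omega
  · rw [Finset.prod_insert h0, prod_nthRootsFinset_one_X_sub_C, C_0]
    ring

theorem isGappedNodeSet_nthRootsFinset_one_union_two [DecidableEq K] (hca : c ≤ a)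
    (hab : a + c + 1 ≤ b) :
    IsGappedNodeSet c b (nthRootsFinset (a + 1) (1 : K) ∪ nthRootsFinset (b - a) (2 : K)) := by
  have hba : b - a ≠ 0 := by omega
  refine ⟨2 - X ^ (b - a) - 2 * X ^ (a + 1), ?_, ?_⟩
  · have : (2 - X ^ (b - a) - 2 * X ^ (a + 1) : K[X]).natDegree ≤ max (b - a) (a + 1) := by
      compute_degree
    omega
  · have hpow : (X ^ (b + 1) : K[X]) = X ^ (a + 1) * X ^ (b - a) := by
      rw [← pow_add]
      congr 1
      omega
    rw [Finset.prod_union (disjoint_nthRootsFinset_one_two a.succ_ne_zero hba),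
      prod_nthRootsFinset_one_X_sub_C,
      prod_nthRootsFinset_X_sub_C (Nat.cast_ne_zero.2 hba) two_ne_zero, hpow, C_ofNat]
    ring

theorem exists_isGappedNodeSet_nested (hca : c ≤ a)
    (hab : b = a ∨ b = a + 1 ∨ a + c + 1 ≤ b) :
    ∃ R S : Finset K, R ⊆ S ∧ IsGappedNodeSet c a R ∧ IsGappedNodeSet c b S := by
  classical
  have hR := isGappedNodeSet_nthRootsFinset_one (K := K) hca
  rcases hab with rfl | rfl | hb
  · exact ⟨_, _, subset_rfl, hR, hR⟩
  · exact ⟨_, _, Finset.subset_insert _ _, hR, isGappedNodeSet_insert_zero_nthRootsFinset_one hca⟩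
  · exact ⟨_, _, Finset.subset_union_left, hR, isGappedNodeSet_nthRootsFinset_one_union_two hca hb⟩

theorem exists_isGappedNodeSet_card_inter [DecidableEq K] (ha : c ≤ a) (hb : c ≤ b)
    (hab : |(a : ℤ) - b| = 0 ∨ |(a : ℤ) - b| = 1 ∨ (c : ℤ) + 1 ≤ |(a : ℤ) - b|) :
    ∃ R S : Finset K, IsGappedNodeSet c a R ∧ IsGappedNodeSet c b S ∧
      (R ∩ S).card = a ⊓ b + 1 := by
  rcases le_total a b with h | h
  · obtain ⟨R, S, hRS, hR, hS⟩ := exists_isGappedNodeSet_nested (K := K) (b := b) ha (by grind)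
    refine ⟨R, S, hR, hS, ?_⟩
    rw [Finset.inter_eq_left.2 hRS, hR.card_eq, inf_eq_left.2 h]
  · obtain ⟨S, R, hSR, hS, hR⟩ := exists_isGappedNodeSet_nested (K := K) (b := a) hb (by grind)
    refine ⟨R, S, hR, hS, ?_⟩
    rw [Finset.inter_eq_right.2 hSR, hS.card_eq, inf_eq_right.2 h]

end NodeSets

section WaringRank

open MvPolynomial

variable {n c : ℕ} {a b : Fin n → ℕ}

theorem specialMonomial_eq_monomial (c : ℕ) (a : Fin n → ℕ) :
    specialMonomial c a = monomial (Finsupp.cons c (Finsupp.equivFunOnFinite.symm a)) 1 := by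
  rw [monomial_eq, Finsupp.prod_fintype _ _ (by simp), Fin.prod_univ_succ]
  simp [specialMonomial]

theorem totalDegree_specialMonomial (c : ℕ) (a : Fin n → ℕ) :
    (specialMonomial c a).totalDegree =
      (Finsupp.cons c (Finsupp.equivFunOnFinite.symm a)).degree := by
  rw [specialMonomial_eq_monomial, totalDegree_monomial _ one_ne_zero]
  rfl

theorem isHomogeneous_one_iff_exists_eq_sum_smul_X {σ R : Type*} [Fintype σ] [CommSemiring R]
    {L : MvPolynomial σ R} : L.IsHomogeneous 1 ↔ ∃ l : σ → R, ∑ i, l i • X i = L := by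
  rw [← mem_homogeneousSubmodule, homogeneousSubmodule_one_eq_span_X,
    Submodule.mem_span_range_iff_exists_fun]

theorem hasSimultaneousWaringDecomposition_image_specialMonomial_iff {A : Set (Fin n → ℕ)}
    {r : ℕ} :
    HasSimultaneousWaringDecomposition (specialMonomial c '' A) r ↔
      ∃ p : Fin r → Fin (n + 1) → ℂ, ∀ a ∈ A,
        IsApolar (Set.range p) (Finsupp.cons c (Finsupp.equivFunOnFinite.symm a)) := by
  simp only [HasSimultaneousWaringDecomposition, isHomogeneous_one_iff_exists_eq_sum_smul_X,
    Set.forall_mem_image, isApolar_range_iff_exists_monomial_eq_sum_pow,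
    ← specialMonomial_eq_monomial, ← totalDegree_specialMonomial]
  refine ⟨fun ⟨L, hL, h⟩ => ?_, fun ⟨p, h⟩ => ⟨_, fun j => ⟨p j, rfl⟩, fun a ha => h a ha⟩⟩
  choose p hp using hL
  obtain rfl : (fun j => ∑ i, p j i • X i) = L := funext hp
  exact ⟨p, fun a ha => h ha⟩

theorem hasSimultaneousWaringDecomposition_card {A : Set (Fin n → ℕ)}
    {Z : Finset (Fin (n + 1) → ℂ)}
    (h : ∀ a ∈ A, IsApolar (Z : Set (Fin (n + 1) → ℂ))
      (Finsupp.cons c (Finsupp.equivFunOnFinite.symm a))) :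
    HasSimultaneousWaringDecomposition (specialMonomial c '' A) Z.card := by
  refine hasSimultaneousWaringDecomposition_image_specialMonomial_iff.2
    ⟨fun j => Z.equivFin.symm j, fun a ha => (h a ha).mono fun z hz => ?_⟩
  exact ⟨Z.equivFin ⟨z, hz⟩, by simp⟩

theorem card_biUnion_Iic_le_of_hasSimultaneousWaringDecomposition (hc : c ≠ 0)
    {A : Finset (Fin n → ℕ)} {r : ℕ}
    (h : HasSimultaneousWaringDecomposition (specialMonomial c '' (A : Set (Fin n → ℕ))) r) :
    (A.biUnion Finset.Iic).card ≤ r := by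
  classical
  obtain ⟨p, hp⟩ := hasSimultaneousWaringDecomposition_image_specialMonomial_iff.1 h
  have hcard : ((A.biUnion Finset.Iic).map Finsupp.equivFunOnFinite.symm.toEmbedding).card ≤
      (Finset.univ.image p).card := by
    refine card_le_card_of_isApolar hc fun m hm => ?_
    obtain ⟨e, he, rfl⟩ := Finset.mem_map.1 hm
    obtain ⟨a, ha, hea⟩ := Finset.mem_biUnion.1 he
    exact ⟨_, fun i => Finset.mem_Iic.1 hea i, (hp a ha).mono (by simp)⟩
  rw [Finset.card_map] at hcard
  simpa using hcard.trans Finset.card_image_le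

theorem simultaneousWaringRank_eq_of_forall_le {r : ℕ} {𝓕 : Set (MvPolynomial (Fin (n + 1)) ℂ)}
    (h : HasSimultaneousWaringDecomposition 𝓕 r)
    (hle : ∀ s, HasSimultaneousWaringDecomposition 𝓕 s → r ≤ s) :
    simultaneousWaringRank 𝓕 = r :=
  le_antisymm (iInf₂_le r h) (le_iInf₂ fun s hs => by exact_mod_cast hle s hs)

theorem Iic_inter_Iic_eq_Iic_inf {α : Type*} [SemilatticeInf α] [LocallyFiniteOrderBot α]
    [DecidableEq α] (x y : α) : Finset.Iic x ∩ Finset.Iic y = Finset.Iic (x ⊓ y) := by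
  ext z
  simp

theorem exists_isApolar_card_eq_card_Iic_union (ha : ∀ i, c ≤ a i) (hb : ∀ i, c ≤ b i)
    (hab : ∀ i, |(a i : ℤ) - (b i : ℤ)| = 0 ∨ |(a i : ℤ) - (b i : ℤ)| = 1 ∨
      (c : ℤ) + 1 ≤ |(a i : ℤ) - (b i : ℤ)|) :
    ∃ Z : Finset (Fin (n + 1) → ℂ), Z.card = (Finset.Iic a ∪ Finset.Iic b).card ∧
      ∀ e ∈ ({a, b} : Set (Fin n → ℕ)), IsApolar (Z : Set (Fin (n + 1) → ℂ))
        (Finsupp.cons c (Finsupp.equivFunOnFinite.symm e)) := by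
  classical
  choose R S hR hS hRS using fun i =>
    exists_isGappedNodeSet_card_inter (K := ℂ) (ha i) (hb i) (hab i)
  refine ⟨(Fintype.piFinset R ∪ Fintype.piFinset S).image (Matrix.vecCons 1), ?_, ?_⟩
  · rw [Finset.card_image_of_injective _ fun _ _ h => (Matrix.vecCons_inj.1 h).2, Finset.card_union,
      Finset.card_union, ← Fintype.piFinset_inter, Iic_inter_Iic_eq_Iic_inf]
    simp only [Fintype.card_piFinset, (hR _).card_eq, (hS _).card_eq, hRS, Pi.card_Iic,
      Nat.card_Iic, Pi.inf_apply]
  · rw [Finset.coe_image, Finset.coe_union, Set.image_union]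
    rintro e (rfl | rfl)
    · exact (isApolar_grid hR).mono Set.subset_union_left
    · exact (isApolar_grid hS).mono Set.subset_union_right

theorem simultaneousWaringRank_pair_specialMonomial (hc : c ≠ 0)
    (ha : ∀ i, c ≤ a i) (hb : ∀ i, c ≤ b i)
    (hab : ∀ i, |(a i : ℤ) - (b i : ℤ)| = 0 ∨ |(a i : ℤ) - (b i : ℤ)| = 1 ∨
      (c : ℤ) + 1 ≤ |(a i : ℤ) - (b i : ℤ)|) :
    simultaneousWaringRank {specialMonomial c a, specialMonomial c b} =
      (Finset.Iic a ∪ Finset.Iic b).card := by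
  obtain ⟨Z, hZ, hZapolar⟩ := exists_isApolar_card_eq_card_Iic_union ha hb hab
  rw [← Set.image_pair]
  refine simultaneousWaringRank_eq_of_forall_le ?_ fun s hs => ?_
  · rw [← hZ]
    exact hasSimultaneousWaringDecomposition_card hZapolar
  · have hcard := card_biUnion_Iic_le_of_hasSimultaneousWaringDecomposition hc (A := {a, b})
      (by rwa [Finset.coe_pair])
    rwa [Finset.biUnion_insert, Finset.singleton_biUnion] at hcard

theorem waringRank_specialMonomial (hc : c ≠ 0) (ha : ∀ i, c ≤ a i) :
    waringRank (specialMonomial c a) = (Finset.Iic a).card := by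
  simpa [waringRank] using simultaneousWaringRank_pair_specialMonomial hc ha ha (by simp)

theorem hasSimultaneousWaringDecomposition_C_mul {r : ℕ}
    {F : MvPolynomial (Fin (n + 1)) ℂ} {u : ℂ} (hu : u ≠ 0)
    (h : HasSimultaneousWaringDecomposition {F} r) :
    HasSimultaneousWaringDecomposition {C u * F} r := by
  obtain ⟨L, hL, h⟩ := h
  obtain ⟨w, hw⟩ := h F rfl
  refine ⟨L, hL, ?_⟩
  rintro _ rfl
  have hdeg : (C u * F).totalDegree = F.totalDegree := by
    rw [totalDegree, totalDegree, ← smul_eq_C_mul, support_smul_eq hu]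
  refine ⟨fun j => u * w j, ?_⟩
  rw [hdeg]
  conv_lhs => rw [hw, Finset.mul_sum]
  exact Finset.sum_congr rfl fun j _ => by rw [map_mul, mul_assoc]

theorem waringRank_C_mul (F : MvPolynomial (Fin (n + 1)) ℂ) {u : ℂ} (hu : u ≠ 0) :
    waringRank (C u * F) = waringRank F := by
  have h : ∀ r, HasSimultaneousWaringDecomposition {C u * F} r ↔
      HasSimultaneousWaringDecomposition {F} r := by
    refine fun r => ⟨fun h => ?_, hasSimultaneousWaringDecomposition_C_mul hu⟩
    have hF := hasSimultaneousWaringDecomposition_C_mul (inv_ne_zero hu) h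
    rwa [← mul_assoc, ← map_mul, inv_mul_cancel₀ hu, map_one, one_mul] at hF
  simp only [waringRank, simultaneousWaringRank, h]

theorem exists_eq_C_mul_of_isGreatestCommonDivisor
    {D : MvPolynomial (Fin (n + 1)) ℂ}
    (hD : IsGreatestCommonDivisor (specialMonomial c a) (specialMonomial c b) D) :
    ∃ u : ℂ, u ≠ 0 ∧ D = C u * specialMonomial c (a ⊓ b) := by
  obtain ⟨hDa, hDb, hgreatest⟩ := hD
  have hdvd : ∀ e f : Fin n → ℕ, e ≤ f → specialMonomial c e ∣ specialMonomial c f :=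
    fun e f hef => mul_dvd_mul_left _
      (Finset.prod_dvd_prod_of_dvd _ _ fun i _ => pow_dvd_pow _ (hef i))
  have hinfD := hgreatest _ (hdvd _ a inf_le_left) (hdvd _ b inf_le_right)
  rw [specialMonomial_eq_monomial] at hDa hDb hinfD
  obtain ⟨m, u, hma, hu, rfl⟩ := (dvd_monomial_iff_exists one_ne_zero).1 hDa
  have hu0 : u ≠ 0 := by
    rintro rfl
    simp at hu
  have hmb := (monomial_dvd_monomial.1 hDb).1.resolve_left one_ne_zero
  have hle := (monomial_dvd_monomial.1 hinfD).1.resolve_left hu0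
  refine ⟨u, hu0, ?_⟩
  rw [specialMonomial_eq_monomial, C_mul_monomial, mul_one]
  congr 2
  refine le_antisymm (fun i => Fin.cases ?_ (fun i => ?_) i) hle
  · exact hma 0
  · exact le_inf (hma i.succ) (hmb i.succ)

end WaringRank

theorem mainTheorem1 (n c : ℕ) (a b : Fin n → ℕ) (hc : 1 ≤ c)
    (ha : ∀ i, c ≤ a i) (hb : ∀ i, c ≤ b i)
    (hab : ∀ i, |(a i : ℤ) - (b i : ℤ)| = 0 ∨ |(a i : ℤ) - (b i : ℤ)| = 1 ∨
      (c : ℤ) + 1 ≤ |(a i : ℤ) - (b i : ℤ)|)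
    (M₁ M₂ M₁₂ : MvPolynomial (Fin (n + 1)) ℂ)
    (hM₁ : M₁ = specialMonomial c a) (hM₂ : M₂ = specialMonomial c b)
    (hM₁₂ : IsGreatestCommonDivisor M₁ M₂ M₁₂) :
    ∃ r r₁ r₂ r₁₂ : ℕ,
      simultaneousWaringRank {M₁, M₂} = r ∧ waringRank M₁ = r₁ ∧ waringRank M₂ = r₂ ∧
        waringRank M₁₂ = r₁₂ ∧ (r : ℤ) = (r₁ : ℤ) + (r₂ : ℤ) - (r₁₂ : ℤ) := by
  subst hM₁ hM₂
  have hc0 : c ≠ 0 := Nat.one_le_iff_ne_zero.1 hc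
  obtain ⟨u, hu, rfl⟩ := exists_eq_C_mul_of_isGreatestCommonDivisor hM₁₂
  refine ⟨_, _, _, _, simultaneousWaringRank_pair_specialMonomial hc0 ha hb hab,
    waringRank_specialMonomial hc0 ha, waringRank_specialMonomial hc0 hb,
    (waringRank_C_mul _ hu).trans
      (waringRank_specialMonomial hc0 fun i => le_inf (ha i) (hb i)), ?_⟩
  rw [← Iic_inter_Iic_eq_Iic_inf, eq_sub_iff_add_eq]
  exact_mod_cast Finset.card_union_add_card_inter (Finset.Iic a) (Finset.Iic b)
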